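/- Let $\mathcal H$ and $\mathcal G$ be real Hilbert spaces, let $A\colon\mathcal H\to 2^{\mathcal H}$ and $B\colon\mathcal G\to 2^{\mathcal G}$ be maximally monotone operators, and let $L\colon\mathcal H\to\mathcal G$ be a bounded linear operator such that the set $$\boldsymbol Z=\{(x,u)\in\mathcal H\times\mathcal G \mid 0\in Ax+L^*u,\ 0\in B^{-1}u-Lx\}$$ is non-empty. Let $\Upsilon\colon\mathcal H\to\mathcal H$ and $\Sigma\colon\mathcal G\to\mathcal G$ be bounded linear operators that are self-adjoint and strongly monotone and satisfy $\|\sqrt{\Sigma}\,L\sqrt{\Upsilon}\|\le 1$, where $\sqrt{\cdot}$ is the positive square root. On the Hilbert direct sum $\mathcal H\oplus\mathcal G$ put $$\boldsymbol V(x,u)=(\Upsilon^{-1}x-L^*u,\ \Sigma^{-1}u-Lx),\qquad \boldsymbol M(x,u)=(Ax+L^*u)\times(B^{-1}u-Lx),$$ $$\boldsymbol W(x,u)=\{(y,v)\mid \boldsymbol V(y,v)\in\boldsymbol M(x,u)\},$$ and suppose that $\operatorname{ran}\boldsymbol V$ is closed. Let $P_{\operatorname{ran}\boldsymbol V}$ be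 the orthogonal projection of $\mathcal H\oplus\mathcal G$ onto $\operatorname{ran}\boldsymbol V$, let $J_C=(\mathrm{Id}+C)^{-1}$ denote the resolvent of a set-valued operator $C$, and let $\langle\cdot\mid\cdot\rangle_{\boldsymbol V}=\langle\cdot\mid\boldsymbol V\cdot\rangle$. Then: 1. The resolvents $J_{\Upsilon A}$, $J_{\Sigma B^{-1}}$ and $J_{\boldsymbol W}$ are everywhere defined and single-valued, and $(\operatorname{ran}\boldsymbol V,\langle\cdot\mid\cdot\rangle_{\boldsymbol V})$ is a real Hilbert space. 2. Let $(\lambda_n)_{n\in\mathbb N}$ be a sequence in $[0,2]$ with $\sum_{n\in\mathbb N}\lambda_n(2-\lambda_n)=+\infty$, let $(x_0,u_0)\in\mathcal H\times\mathcal G$, and let, for every $n\in\mathbb N$, $$p_{n+1}=J_{\Upsilon A}(x_n-\Upsilon L^*u_n),\qquad q_{n+1}=J_{\Sigma B^{-1}}\big(u_n+\Sigma L(2p_{n+1}-x_n)\big),$$ $$(x_{n+1},u_{n+1})=(1-\lambda_n)(x_n,u_n)+\lambda_n(p_{n+1},q_{n+1}).$$ Then $\big(P_{\operatorname{ran}\boldsymbol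 V}(x_n,u_n)\big)_{n\in\mathbb N}$ converges weakly in $(\operatorname{ran}\boldsymbol V,\langle\cdot\mid\cdot\rangle_{\boldsymbol V})$ to some $(\hat y,\hat v)\in\operatorname{Fix}(P_{\operatorname{ran}\boldsymbol V}\circ J_{\boldsymbol W})$. Moreover, with $$\hat x=J_{\Upsilon A}(\hat y-\Upsilon L^*\hat v),\qquad \hat u=J_{\Sigma B^{-1}}\big(\hat v+\Sigma L(2\hat x-\hat y)\big),$$ the pair $(\hat x,\hat u)$ belongs to $\boldsymbol Z$. -/

import Mathlib

open Filter Topology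

namespace PrimalDual

noncomputable section

section SetValued

variable {H : Type*} [NormedAddCommGroup H] [InnerProductSpace ℝ H]

/-- A set-valued operator `A : H → 2^H` is maximally monotone if `(x, u)` belongs to its graph
exactly when `⟪x - y, u - v⟫ ≥ 0` for every `(y, v)` in its graph. -/
def MaximallyMonotone (A : H → Set H) : Prop :=
  ∀ x u, u ∈ A x ↔ ∀ y, ∀ v ∈ A y, 0 ≤ inner ℝ (x - y) (u - v)

/-- The inverse of a set-valued operator: `A⁻¹ u = {x | u ∈ A x}`. -/
def setInv (A : H → Set H) : H → Set H := fun u => {x | u ∈ A x}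

/-- The set-valued operator `T A : x ↦ {T a | a ∈ A x}` for a single-valued linear `T`. -/
def setComp (T : H →L[ℝ] H) (A : H → Set H) : H → Set H := fun x => T '' A x

/-- The resolvent `J_A = (Id + A)⁻¹`, as a set-valued operator. -/
def setResolvent (A : H → Set H) : H → Set H :=
  setInv (fun p => {x | ∃ a ∈ A p, x = p + a})

/-- The fixed points of a set-valued operator. -/
def setFix (T : H → Set H) : Set H := {z | z ∈ T z}

end SetValued

section Operators

variable {E : Type*} [NormedAddCommGroup E] [InnerProductSpace ℝ E]

/-- Strong monotonicity of an operator, for some constant `β > 0`. -/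
def StronglyMonotone (T : E →L[ℝ] E) : Prop :=
  ∃ β : ℝ, 0 < β ∧ ∀ x y, β * ‖x - y‖ ^ 2 ≤ inner ℝ (x - y) (T x - T y)

open Classical in
/-- The positive (self-adjoint monotone) square root of a bounded operator; it exists for all the
operators it is applied to, see `posSqrt_spec`. -/
def posSqrt (T : E →L[ℝ] E) : E →L[ℝ] E :=
  if h : ∃ R : E →L[ℝ] E, R.IsPositive ∧ R * R = T then h.choose else 0

/-- A strongly monotone bounded operator is invertible, so `T.inverse` is its true inverse. -/
theorem StronglyMonotone.isInvertible [CompleteSpace E] {T : E →L[ℝ] E}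
    (hT : StronglyMonotone T) : T.IsInvertible := by
  obtain ⟨β, hβ, h⟩ := hT
  have hu : IsUnit T := by
    refine ContinuousLinearMap.isUnit_of_forall_le_norm_inner_map T (c := ⟨β, hβ.le⟩) hβ ?_
    intro x
    have := h x 0
    simp only [sub_zero, map_zero] at this
    rw [real_inner_comm] at this
    calc ‖x‖ ^ 2 * β = β * ‖x‖ ^ 2 := mul_comm _ _
      _ ≤ inner ℝ (T x) x := this
      _ ≤ ‖inner ℝ (T x) x‖ := le_abs_self _
  obtain ⟨u, rfl⟩ := hu
  exact ⟨ContinuousLinearEquiv.unitsEquiv ℝ E u, rfl⟩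

/-- A square root of `1 - X` for `‖X‖ < 1`, by the contraction principle. -/
theorem exists_posSqrt_one_sub [CompleteSpace E] {X : E →L[ℝ] E} (hX : IsSelfAdjoint X) {c : ℝ}
    (hc : ‖X‖ ≤ c) (hc1 : c < 1) : ∃ R : E →L[ℝ] E, R.IsPositive ∧ R * R = 1 - X := by
  have hc0 : 0 ≤ c := (norm_nonneg _).trans hc
  let f : (E →L[ℝ] E) → (E →L[ℝ] E) := fun Y => (1 / 2 : ℝ) • (Y * Y + X)
  let s : Set (E →L[ℝ] E) := {Y | IsSelfAdjoint Y} ∩ Metric.closedBall 0 c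
  have hs : IsComplete s := by
    refine IsClosed.isComplete (IsClosed.inter ?_ Metric.isClosed_closedBall)
    exact isClosed_eq continuous_star continuous_id
  have hmem : ∀ Y ∈ s, ‖Y‖ ≤ c := fun Y hY => by simpa using hY.2
  have hf : Set.MapsTo f s s := by
    intro Y hY
    refine ⟨?_, ?_⟩
    · have h1 : IsSelfAdjoint Y := hY.1
      have h2 : IsSelfAdjoint (Y * Y) := by
        rw [← pow_two]; exact h1.pow 2
      exact (IsSelfAdjoint.all (1 / 2 : ℝ)).smul (h2.add hX)
    · have hn := hmem Y hY
      have h1 : ‖Y * Y + X‖ ≤ c * c + c :=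
        (norm_add_le _ _).trans (add_le_add ((norm_mul_le _ _).trans
          (mul_le_mul hn hn (norm_nonneg _) hc0)) hc)
      have h2 : ‖f Y‖ = 1 / 2 * ‖Y * Y + X‖ := by
        simp only [f, norm_smul]; norm_num
      rw [mem_closedBall_zero_iff, h2]
      nlinarith
  have hcon : ContractingWith ⟨c, hc0⟩ (hf.restrict f s s) := by
    refine ⟨hc1, LipschitzWith.of_dist_le_mul ?_⟩
    rintro ⟨Y, hY⟩ ⟨Z, hZ⟩
    have h0 : f Y - f Z = (1 / 2 : ℝ) • (Y * (Y - Z) + (Y - Z) * Z) := by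
      simp only [f, ← smul_sub]; congr 1; noncomm_ring
    have h1 : ‖Y * (Y - Z) + (Y - Z) * Z‖ ≤ c * ‖Y - Z‖ + ‖Y - Z‖ * c :=
      (norm_add_le _ _).trans (add_le_add
        ((norm_mul_le _ _).trans (mul_le_mul_of_nonneg_right (hmem Y hY) (norm_nonneg _)))
        ((norm_mul_le _ _).trans (mul_le_mul_of_nonneg_left (hmem Z hZ) (norm_nonneg _))))
    have h2 : ‖f Y - f Z‖ ≤ c * ‖Y - Z‖ := by
      rw [h0, norm_smul]
      norm_num
      linarith
    rw [Subtype.dist_eq, Subtype.dist_eq, dist_eq_norm, dist_eq_norm]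
    exact h2
  have h0 : (0 : E →L[ℝ] E) ∈ s := ⟨IsSelfAdjoint.zero _, by simpa using hc0⟩
  obtain ⟨Y, hY, hfix, -⟩ := hcon.exists_fixedPoint' hs hf h0 (edist_ne_top _ _)
  have hfix' : Y * Y + X = (2 : ℝ) • Y := by
    have h : (1 / 2 : ℝ) • (Y * Y + X) = Y := hfix
    calc Y * Y + X = (2 : ℝ) • ((1 / 2 : ℝ) • (Y * Y + X)) := by rw [smul_smul]; norm_num
      _ = (2 : ℝ) • Y := by rw [h]
  refine ⟨1 - Y, ?_, ?_⟩
  · rw [ContinuousLinearMap.isPositive_iff']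
    refine ⟨(IsSelfAdjoint.one _).sub hY.1, fun x => ?_⟩
    have h1 : inner ℝ (Y x) x ≤ c * ‖x‖ * ‖x‖ :=
      (real_inner_le_norm _ _).trans (mul_le_mul_of_nonneg_right
        (Y.le_of_opNorm_le (hmem Y hY) x) (norm_nonneg _))
    have h2 : inner ℝ x x = ‖x‖ * ‖x‖ := real_inner_self_eq_norm_mul_norm x
    rw [show (1 - Y) x = x - Y x by simp, inner_sub_left, h2]
    nlinarith [mul_nonneg (norm_nonneg x) (norm_nonneg x)]
  · have : (1 - Y) * (1 - Y) = 1 - (2 : ℝ) • Y + Y * Y := by rw [two_smul]; noncomm_ring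
    rw [this, ← hfix']
    abel

theorem exists_posSqrt [CompleteSpace E] {T : E →L[ℝ] E} (hT : IsSelfAdjoint T)
    (hm : StronglyMonotone T) : ∃ R : E →L[ℝ] E, R.IsPositive ∧ R * R = T := by
  obtain ⟨β, hβ, h⟩ := hm
  set M : ℝ := ‖T‖
  have hM : 0 ≤ M := norm_nonneg _
  set t : ℝ := β / (M ^ 2 + β ^ 2 + 1) with ht
  have hD : 0 < M ^ 2 + β ^ 2 + 1 := by positivity
  have htpos : 0 < t := by positivity
  have htD : t * (M ^ 2 + β ^ 2 + 1) = β := by rw [ht]; field_simp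
  set d : ℝ := 1 - t * β
  have hd0 : 0 ≤ d := by
    have : t * β ≤ 1 := by
      rw [ht, div_mul_eq_mul_div, div_le_one hD]; nlinarith
    simp only [d]; linarith
  have hd1 : d < 1 := by
    have : 0 < t * β := by positivity
    simp only [d]; linarith
  have hX : IsSelfAdjoint (1 - t • T) :=
    (IsSelfAdjoint.one _).sub ((IsSelfAdjoint.all t).smul hT)
  have hn : ‖1 - t • T‖ ≤ √d := by
    refine ContinuousLinearMap.opNorm_le_bound _ (Real.sqrt_nonneg _) fun x => ?_
    refine abs_le_of_sq_le_sq' ?_ (by positivity) |>.2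
    rw [mul_pow, Real.sq_sqrt hd0]
    have h1 : (1 - t • T) x = x - t • T x := by simp
    have h2 := h x 0
    simp only [sub_zero, map_zero] at h2
    have h3 : ‖T x‖ ^ 2 ≤ M ^ 2 * ‖x‖ ^ 2 := by
      rw [← mul_pow]
      exact pow_le_pow_left₀ (norm_nonneg _) (T.le_opNorm x) 2
    have h5 : t * M ^ 2 ≤ β := by nlinarith
    have h6 : t * t * ‖T x‖ ^ 2 ≤ t * β * ‖x‖ ^ 2 := by
      calc t * t * ‖T x‖ ^ 2 ≤ t * t * (M ^ 2 * ‖x‖ ^ 2) :=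
            mul_le_mul_of_nonneg_left h3 (by positivity)
        _ = t * (t * M ^ 2) * ‖x‖ ^ 2 := by ring
        _ ≤ t * β * ‖x‖ ^ 2 := by gcongr
    have h4 : t * (β * ‖x‖ ^ 2) ≤ t * inner ℝ x (T x) := mul_le_mul_of_nonneg_left h2 htpos.le
    have h7 : ‖t • T x‖ ^ 2 = t * t * ‖T x‖ ^ 2 := by
      rw [norm_smul, mul_pow, Real.norm_eq_abs, sq_abs]; ring
    rw [h1, norm_sub_sq_real, inner_smul_right, h7]
    simp only [d]
    linarith
  obtain ⟨R, hR, hRR⟩ := exists_posSqrt_one_sub hX hn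
    (by rw [← Real.sqrt_one]; exact Real.sqrt_lt_sqrt hd0 hd1)
  refine ⟨(√t)⁻¹ • R, hR.smul_of_nonneg (by positivity), ?_⟩
  have h8 : (√t)⁻¹ * (√t)⁻¹ = t⁻¹ := by
    rw [← mul_inv, Real.mul_self_sqrt htpos.le]
  rw [smul_mul_smul_comm, h8, hRR, sub_sub_cancel, smul_smul, inv_mul_cancel₀ htpos.ne', one_smul]

theorem posSqrt_spec [CompleteSpace E] {T : E →L[ℝ] E} (hT : IsSelfAdjoint T)
    (hm : StronglyMonotone T) : (posSqrt T).IsPositive ∧ posSqrt T * posSqrt T = T := by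
  have h := exists_posSqrt hT hm
  rw [posSqrt, dif_pos h]
  exact h.choose_spec

/-- The range of a bounded operator. -/
def ran (V : E →L[ℝ] E) : Submodule ℝ E := (V : E →ₗ[ℝ] E).range

/-- The orthogonal projection of the Hilbert space `E` onto the closed subspace `ran V`. -/
def projRan [CompleteSpace E] (V : E →L[ℝ] E) (hV : IsClosed (ran V : Set E)) : E →L[ℝ] E :=
  haveI : CompleteSpace (ran V) := hV.completeSpace_coe
  (ran V).starProjection

/-- The form `(z, w) ↦ ⟪z, V w⟫` is an inner product on `K` that makes `K` a Hilbert space. -/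
structure IsHilbertSpaceFor (V : E →L[ℝ] E) (K : Submodule ℝ E) : Prop where
  symm : ∀ z ∈ K, ∀ w ∈ K, inner ℝ z (V w) = inner ℝ w (V z)
  pos : ∀ z ∈ K, z ≠ 0 → 0 < inner ℝ z (V z)
  complete : ∀ f : ℕ → E, (∀ n, f n ∈ K) →
    (∀ ε > 0, ∃ N, ∀ m ≥ N, ∀ n ≥ N, inner ℝ (f m - f n) (V (f m - f n)) < ε) →
    ∃ z ∈ K, Tendsto (fun n => inner ℝ (f n - z) (V (f n - z))) atTop (𝓝 0)

/-- Weak convergence of the sequence `f` to `z` in the Hilbert space `(K, ⟪·, V ·⟫)`. -/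
structure WeaklyConvergesIn (V : E →L[ℝ] E) (K : Submodule ℝ E) (f : ℕ → E) (z : E) : Prop where
  mem : ∀ n, f n ∈ K
  lim_mem : z ∈ K
  tendsto : ∀ w ∈ K, Tendsto (fun n => inner ℝ (f n) (V w)) atTop (𝓝 (inner ℝ z (V w)))

end Operators

section Problem

variable {H G : Type*} [NormedAddCommGroup H] [InnerProductSpace ℝ H] [CompleteSpace H]
  [NormedAddCommGroup G] [InnerProductSpace ℝ G] [CompleteSpace G]

/-- The set `Z` of primal-dual solutions: `(x, u)` with `0 ∈ A x + L* u` and `0 ∈ B⁻¹ u - L x`. -/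
def solutions (A : H → Set H) (B : G → Set G) (L : H →L[ℝ] G) : Set (WithLp 2 (H × G)) :=
  {z | (∃ a ∈ A z.fst, a + L.adjoint z.snd = 0) ∧ (∃ b ∈ setInv B z.snd, b - L z.fst = 0)}

/-- `M (x, u) = (A x + L* u) × (B⁻¹ u - L x)`. -/
def opM (A : H → Set H) (B : G → Set G) (L : H →L[ℝ] G) :
    WithLp 2 (H × G) → Set (WithLp 2 (H × G)) :=
  fun z => {y | (∃ a ∈ A z.fst, y.fst = a + L.adjoint z.snd) ∧
    (∃ b ∈ setInv B z.snd, y.snd = b - L z.fst)}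

/-- `V (x, u) = (Υ⁻¹ x - L* u, Σ⁻¹ u - L x)` on the Hilbert direct sum of `H` and `G`; here `U`
stands for `Υ` and `S` for `Σ`. -/
def opV (U : H →L[ℝ] H) (S : G →L[ℝ] G) (L : H →L[ℝ] G) :
    WithLp 2 (H × G) →L[ℝ] WithLp 2 (H × G) :=
  (WithLp.prodContinuousLinearEquiv 2 ℝ H G).symm.toContinuousLinearMap ∘L
    ((U.inverse ∘L WithLp.fstL 2 ℝ H G - L.adjoint ∘L WithLp.sndL 2 ℝ H G).prod
      (S.inverse ∘L WithLp.sndL 2 ℝ H G - L ∘L WithLp.fstL 2 ℝ H G))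

theorem opV_apply (U : H →L[ℝ] H) (S : G →L[ℝ] G) (L : H →L[ℝ] G) (x : H) (u : G) :
    opV U S L (WithLp.toLp 2 (x, u)) =
      WithLp.toLp 2 (U.inverse x - L.adjoint u, S.inverse u - L x) := rfl

/-- `W (x, u) = {(y, v) | V (y, v) ∈ M (x, u)}`. -/
def opW (A : H → Set H) (B : G → Set G) (U : H →L[ℝ] H) (S : G →L[ℝ] G) (L : H →L[ℝ] G) :
    WithLp 2 (H × G) → Set (WithLp 2 (H × G)) :=
  fun z => {y | opV U S L y ∈ opM A B L z}

end Problem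

end

end PrimalDual

/-! The norm bound makes Q(z) = ⟪z, V z⟫ positive semidefinite, and M is monotone, being A × B⁻¹
plus a skew coupling. Since w ∈ J_W z means V (z - w) ∈ M w, monotonicity of M makes J_W firmly
nonexpansive for Q (`firmlyNonexpansiveFor_opV`). This inclusion is triangular: the resolvent of ΥA
gives the first coordinate of w, then that of ΣB⁻¹ gives the second. Both resolvents exist by
Minty's theorem, obtained by minimizing the Fitzpatrick function plus half the squared norm, and
applied to √Υ A √Υ and its analogue for B⁻¹.

The algorithm is therefore the Krasnosel'skiĭ–Mann iteration of J_W in a seminorm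
(`FirmlyNonexpansiveFor.exists_weak_limit`). As V is symmetric, its kernel is (ran V)ᗮ, so Q sees
only the projection onto ran V; closedness of ran V makes Q coercive there (`exists_coercive`).
Fejér monotonicity, vanishing residuals, demiclosedness and Opial's argument then give a weak limit
y with V (J y) = V y. Hence 0 = V (y - J y) ∈ M (J y): it is J y, not necessarily y, that solves the
problem, and projecting J y back onto ran V returns y. -/

namespace PrimalDual

/-! ### Minty's theorem and resolvents of maximally monotone operators -/

section Minty

variable {E : Type*} [NormedAddCommGroup E] [InnerProductSpace ℝ E]

theorem half_norm_sq_midpoint (a b : E) :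
    ‖(1 / 2 : ℝ) • (a + b)‖ ^ 2 = ‖a‖ ^ 2 / 2 + ‖b‖ ^ 2 / 2 - ‖a - b‖ ^ 2 / 4 := by
  rw [norm_smul, mul_pow, norm_add_sq_real, norm_sub_sq_real, Real.norm_eq_abs, sq_abs]
  ring

/-- The function `(z, t) ↦ t + ‖z‖² / 2` attains its minimum on a closed convex set on which it is
bounded below. -/
theorem exists_min_add_half_norm_sq [CompleteSpace E] {C : Set (E × ℝ)} (hC : IsClosed C)
    (hconv : Convex ℝ C) (hne : C.Nonempty) (hbd : ∀ w ∈ C, 0 ≤ w.2 + ‖w.1‖ ^ 2 / 2) :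
    ∃ w₀ ∈ C, ∀ w ∈ C, w₀.2 + ‖w₀.1‖ ^ 2 / 2 ≤ w.2 + ‖w.1‖ ^ 2 / 2 := by
  set φ : E × ℝ → ℝ := fun w => w.2 + ‖w.1‖ ^ 2 / 2 with hφ
  have hB : BddBelow (φ '' C) := ⟨0, by rintro _ ⟨w, hw, rfl⟩; exact hbd w hw⟩
  set m := sInf (φ '' C)
  have hm : ∀ w ∈ C, m ≤ φ w := fun w hw => csInf_le hB ⟨w, hw, rfl⟩
  have hseq : ∀ n : ℕ, ∃ w ∈ C, φ w < m + 1 / ((n : ℝ) + 1) := by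
    intro n
    have : m < m + 1 / ((n : ℝ) + 1) := by
      have : (0 : ℝ) < 1 / ((n : ℝ) + 1) := by positivity
      linarith
    obtain ⟨_, ⟨w, hw, rfl⟩, h⟩ := exists_lt_of_csInf_lt (hne.image φ) this
    exact ⟨w, hw, h⟩
  choose a haC ha using hseq
  have hlim : Tendsto (fun n : ℕ => 1 / ((n : ℝ) + 1)) atTop (𝓝 0) :=
    tendsto_one_div_add_atTop_nhds_zero_nat
  -- The midpoint of two near-minimizers stays in `C`, so its value is at least `m`; the
  -- parallelogram law then bounds their distance.
  have key : ∀ i j, ‖(a i).1 - (a j).1‖ ^ 2 ≤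
      4 * (1 / ((i : ℝ) + 1) + 1 / ((j : ℝ) + 1)) := by
    intro i j
    have hmid : (1 / 2 : ℝ) • (a i + a j) ∈ C := by
      rw [smul_add]
      exact hconv (haC i) (haC j) (by norm_num) (by norm_num) (by norm_num)
    have h1 := hm _ hmid
    have h2 := half_norm_sq_midpoint (a i).1 (a j).1
    have hi := ha i
    have hj := ha j
    simp only [hφ, Prod.smul_fst, Prod.smul_snd, Prod.fst_add, Prod.snd_add, smul_eq_mul, h2]
      at h1 hi hj
    linarith
  have hcau : CauchySeq fun n => (a n).1 := by
    rw [Metric.cauchySeq_iff']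
    intro ε hε
    have h8 : Tendsto (fun n : ℕ => 8 * (1 / ((n : ℝ) + 1))) atTop (𝓝 0) := by
      simpa using hlim.const_mul 8
    obtain ⟨N, hN⟩ := (h8.eventually_lt_const (show (0 : ℝ) < ε ^ 2 by positivity)).exists
    refine ⟨N, fun n hn => ?_⟩
    rw [dist_eq_norm]
    refine lt_of_pow_lt_pow_left₀ 2 hε.le (((key n N).trans ?_).trans_lt hN)
    have : 1 / ((n : ℝ) + 1) ≤ 1 / ((N : ℝ) + 1) := by gcongr
    linarith
  obtain ⟨z, hz⟩ := cauchySeq_tendsto_of_complete hcau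
  have hφm : Tendsto (fun n => φ (a n)) atTop (𝓝 m) := by
    refine tendsto_of_tendsto_of_tendsto_of_le_of_le tendsto_const_nhds
      (by simpa using hlim.const_add m) (fun n => hm _ (haC n)) fun n => (ha n).le
  have hz2 : Tendsto (fun n => ‖(a n).1‖ ^ 2 / 2) atTop (𝓝 (‖z‖ ^ 2 / 2)) :=
    (hz.norm.pow 2).div_const 2
  -- The real coordinates are controlled only through `φ (a n) → m`.
  have ht : Tendsto (fun n => (a n).2) atTop (𝓝 (m - ‖z‖ ^ 2 / 2)) := by
    refine (hφm.sub hz2).congr fun n => ?_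
    simp only [hφ]; ring
  refine ⟨(z, m - ‖z‖ ^ 2 / 2), hC.mem_of_tendsto (hz.prodMk_nhds ht)
    (Eventually.of_forall haC), fun w hw => ?_⟩
  have := hm w hw
  simp only [hφ] at this
  simpa using this

/-- The first-order optimality condition for `exists_min_add_half_norm_sq`. -/
theorem sub_inner_le_of_min {C : Set (E × ℝ)} (hconv : Convex ℝ C) {w₀ : E × ℝ} (h₀ : w₀ ∈ C)
    (hmin : ∀ w ∈ C, w₀.2 + ‖w₀.1‖ ^ 2 / 2 ≤ w.2 + ‖w.1‖ ^ 2 / 2) {w : E × ℝ} (hw : w ∈ C) :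
    w₀.2 - inner ℝ w₀.1 (w.1 - w₀.1) ≤ w.2 := by
  set D := w.2 - w₀.2 + inner ℝ w₀.1 (w.1 - w₀.1) with hD
  -- Minimality along the segment from `w₀` to `w`, divided by `s`; letting `s → 0` leaves `0 ≤ D`.
  have h : ∀ s : ℝ, 0 < s → s ≤ 1 → 0 ≤ D + s * (‖w.1 - w₀.1‖ ^ 2 / 2) := by
    intro s hs hs1
    have h1 := hmin _ (hconv.add_smul_sub_mem h₀ hw ⟨hs.le, hs1⟩)
    simp only [Prod.fst_add, Prod.snd_add, Prod.smul_fst, Prod.smul_snd, Prod.fst_sub,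
      Prod.snd_sub, smul_eq_mul] at h1
    rw [norm_add_sq_real, norm_smul, inner_smul_right, mul_pow, Real.norm_eq_abs, sq_abs] at h1
    have h2 : 0 ≤ s * (D + s * (‖w.1 - w₀.1‖ ^ 2 / 2)) := by rw [hD]; linarith
    exact nonneg_of_mul_nonneg_right h2 hs
  have hlim : Tendsto (fun s : ℝ => D + s * (‖w.1 - w₀.1‖ ^ 2 / 2)) (𝓝[>] 0) (𝓝 D) := by
    have : Continuous fun s : ℝ => D + s * (‖w.1 - w₀.1‖ ^ 2 / 2) := by fun_prop
    simpa using (this.tendsto 0).mono_left nhdsWithin_le_nhds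
  have h0 : 0 ≤ D := ge_of_tendsto hlim <| by
    filter_upwards [Ioc_mem_nhdsGT (zero_lt_one (α := ℝ))] with s hs using h s hs.1 hs.2
  linarith

theorem MaximallyMonotone.nonempty_graph {A : E → Set E} (hA : MaximallyMonotone A) :
    ∃ x u, u ∈ A x := by
  by_contra! h
  exact h 0 0 ((hA 0 0).2 fun y v hv => absurd hv (h y v))

theorem MaximallyMonotone.monotone {A : E → Set E} (hA : MaximallyMonotone A) {x u y v : E}
    (hu : u ∈ A x) (hv : v ∈ A y) : 0 ≤ inner ℝ (x - y) (u - v) :=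
  (hA x u).1 hu y v hv

theorem MaximallyMonotone.setInv {A : E → Set E} (hA : MaximallyMonotone A) :
    MaximallyMonotone (setInv A) := fun u x =>
  ⟨fun h y v hv => by rw [real_inner_comm]; exact hA.monotone h hv,
    fun h => (hA x u).2 fun y v hv => by rw [real_inner_comm]; exact h v y hv⟩

/-- The epigraph of the Fitzpatrick function of a set-valued operator. -/
def fitzpatrickEpigraph (A : E → Set E) : Set (WithLp 2 (E × E) × ℝ) :=
  {w | ∀ y, ∀ v ∈ A y, inner ℝ y w.1.snd + inner ℝ w.1.fst v - inner ℝ y v ≤ w.2}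

theorem isClosed_fitzpatrickEpigraph (A : E → Set E) : IsClosed (fitzpatrickEpigraph A) := by
  simp only [fitzpatrickEpigraph, Set.ofPred_forall]
  have h1 : Continuous fun w : WithLp 2 (E × E) × ℝ => w.1.fst :=
    (WithLp.continuous_fst 2 E E).comp continuous_fst
  have h2 : Continuous fun w : WithLp 2 (E × E) × ℝ => w.1.snd :=
    (WithLp.continuous_snd 2 E E).comp continuous_fst
  refine isClosed_iInter fun y => isClosed_iInter fun v => isClosed_iInter fun _ => ?_
  exact isClosed_le (by fun_prop) continuous_snd

theorem convex_fitzpatrickEpigraph (A : E → Set E) : Convex ℝ (fitzpatrickEpigraph A) := by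
  intro w hw w' hw' s t hs ht hst y v hv
  have h1 := mul_le_mul_of_nonneg_left (hw y v hv) hs
  have h2 := mul_le_mul_of_nonneg_left (hw' y v hv) ht
  have h3 : inner ℝ y v = s * inner ℝ y v + t * inner ℝ y v := by rw [← add_mul, hst, one_mul]
  simp only [Prod.fst_add, Prod.snd_add, Prod.smul_fst, Prod.smul_snd, WithLp.add_fst,
    WithLp.add_snd, WithLp.smul_fst, WithLp.smul_snd, inner_add_left, inner_add_right,
    inner_smul_right, real_inner_smul_left, smul_eq_mul]
  linarith

/-- Off the graph, maximality supplies a graph point violating monotonicity, and that point pushes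
the Fitzpatrick function above the duality pairing. -/
theorem MaximallyMonotone.inner_le_of_mem_fitzpatrickEpigraph {A : E → Set E}
    (hA : MaximallyMonotone A) {w : WithLp 2 (E × E) × ℝ} (hw : w ∈ fitzpatrickEpigraph A) :
    inner ℝ w.1.fst w.1.snd ≤ w.2 := by
  by_cases h : w.1.snd ∈ A w.1.fst
  · simpa using hw _ _ h
  · rw [hA] at h
    push Not at h
    obtain ⟨y, v, hv, hlt⟩ := h
    have := hw y v hv
    simp only [inner_sub_left, inner_sub_right] at hlt
    linarith

theorem MaximallyMonotone.mem_fitzpatrickEpigraph {A : E → Set E} (hA : MaximallyMonotone A)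
    {x u : E} (hu : u ∈ A x) :
    ((WithLp.toLp 2 (x, u), inner ℝ x u) : WithLp 2 (E × E) × ℝ) ∈ fitzpatrickEpigraph A := by
  intro y v hv
  have := hA.monotone hu hv
  simp only [inner_sub_left, inner_sub_right] at this
  simp only [WithLp.toLp_fst, WithLp.toLp_snd]
  linarith

theorem norm_add_sq_eq_inner (x u : E) :
    ‖x + u‖ ^ 2 = inner ℝ x x + inner ℝ u u + 2 * inner ℝ x u := by
  rw [norm_add_sq_real, real_inner_self_eq_norm_sq, real_inner_self_eq_norm_sq]; ring

/-- **Minty's theorem**, at the origin. -/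
theorem MaximallyMonotone.exists_neg_mem [CompleteSpace E] {A : E → Set E}
    (hA : MaximallyMonotone A) : ∃ p, -p ∈ A p := by
  have hbd : ∀ w ∈ fitzpatrickEpigraph A, 0 ≤ w.2 + ‖w.1‖ ^ 2 / 2 := by
    intro w hw
    have h1 := hA.inner_le_of_mem_fitzpatrickEpigraph hw
    have h2 := norm_add_sq_eq_inner w.1.fst w.1.snd
    have h3 : ‖w.1‖ ^ 2 = inner ℝ w.1.fst w.1.fst + inner ℝ w.1.snd w.1.snd := by
      rw [← real_inner_self_eq_norm_sq, WithLp.prod_inner_apply]; rfl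
    nlinarith [sq_nonneg ‖w.1.fst + w.1.snd‖]
  obtain ⟨x₁, u₁, h₁⟩ := hA.nonempty_graph
  obtain ⟨⟨z, t⟩, hw, hmin⟩ := exists_min_add_half_norm_sq (isClosed_fitzpatrickEpigraph A)
    (convex_fitzpatrickEpigraph A) ⟨_, hA.mem_fitzpatrickEpigraph h₁⟩ hbd
  have ht := hA.inner_le_of_mem_fitzpatrickEpigraph hw
  have hs := norm_add_sq_eq_inner z.fst z.snd
  -- Optimality tested at graph points. The right side is thus nonnegative, so maximality puts
  -- `(-z.snd, -z.fst)` in the graph; testing there forces `z.fst = -z.snd`.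
  have key : ∀ y, ∀ v ∈ A y, ‖z.fst + z.snd‖ ^ 2 ≤ inner ℝ (-z.snd - y) (-z.fst - v) := by
    intro y v hv
    have := sub_inner_le_of_min (convex_fitzpatrickEpigraph A) hw hmin
      (hA.mem_fitzpatrickEpigraph hv)
    simp only [WithLp.prod_inner_apply, WithLp.ofLp_fst, WithLp.ofLp_snd, inner_sub_left,
      inner_sub_right, inner_neg_left, inner_neg_right] at this ht ⊢
    linarith [real_inner_comm y z.fst, real_inner_comm z.fst z.snd]
  have hmem : -z.fst ∈ A (-z.snd) := (hA _ _).2 fun y v hv => (sq_nonneg _).trans (key y v hv)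
  have h0 := key _ _ hmem
  simp only [sub_self, inner_zero_left] at h0
  have : z.fst = -z.snd := by
    rw [eq_neg_iff_add_eq_zero, ← norm_eq_zero]
    exact pow_eq_zero_iff two_ne_zero |>.1 (le_antisymm h0 (sq_nonneg _))
  refine ⟨-z.snd, ?_⟩
  rwa [← this] at hmem ⊢

/-- **Minty's theorem**. -/
theorem MaximallyMonotone.exists_sub_mem [CompleteSpace E] {A : E → Set E}
    (hA : MaximallyMonotone A) (z : E) : ∃ p, z - p ∈ A p := by
  have hA' : MaximallyMonotone fun x => {u | u + z ∈ A x} := by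
    intro x u
    refine (hA x (u + z)).trans ⟨fun h y v hv => by simpa using h y _ hv, fun h y v hv => ?_⟩
    have := h y (v - z) (by simpa using hv)
    rwa [sub_sub_eq_add_sub] at this
  obtain ⟨p, hp⟩ := hA'.exists_neg_mem
  exact ⟨p, by simpa [sub_eq_neg_add] using hp⟩

theorem StronglyMonotone.inverse_inner_self_pos [CompleteSpace E] {U : E →L[ℝ] E}
    (hm : StronglyMonotone U) {z : E} (hz : z ≠ 0) : 0 < inner ℝ z (U.inverse z) := by
  have hU := hm.isInvertible
  obtain ⟨β, hβ, h⟩ := hm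
  have h1 := h (U.inverse z) 0
  simp only [sub_zero, map_zero, hU.self_apply_inverse] at h1
  have h2 : U.inverse z ≠ 0 := fun h0 => hz (by rw [← hU.self_apply_inverse z, h0, map_zero])
  rw [real_inner_comm]
  have := norm_pos_iff.2 h2
  exact lt_of_lt_of_le (by positivity) h1

theorem mem_setResolvent_setComp_iff [CompleteSpace E] {U : E →L[ℝ] E} (hU : U.IsInvertible)
    {A : E → Set E} {x p : E} :
    p ∈ setResolvent (setComp U A) x ↔ U.inverse (x - p) ∈ A p := by
  constructor
  · rintro ⟨_, ⟨a, ha, rfl⟩, rfl⟩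
    simpa [hU.inverse_apply_self] using ha
  · intro h
    exact ⟨_, ⟨_, h, rfl⟩, by rw [hU.self_apply_inverse]; abel⟩

/-- `U` commutes with its square root, so `U⁻¹ √U` is a two-sided inverse of `√U`. -/
theorem posSqrt_isInvertible [CompleteSpace E] {U : E →L[ℝ] E} (hsa : IsSelfAdjoint U)
    (hm : StronglyMonotone U) : (posSqrt U).IsInvertible := by
  have h := (posSqrt_spec hsa hm).2
  have hi := hm.isInvertible
  refine .of_inverse (g := U.inverse ∘L posSqrt U) ?_ ?_
  · rw [← ContinuousLinearMap.comp_assoc]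
    ext x
    have hc : ∀ y, posSqrt U (U.inverse y) = U.inverse (posSqrt U y) := by
      intro y
      have : U (posSqrt U (U.inverse y)) = posSqrt U y := by
        have hcomm : ∀ w, U (posSqrt U w) = posSqrt U (U w) := fun w =>
          (DFunLike.congr_fun h (posSqrt U w)).symm.trans
            (congrArg (posSqrt U) (DFunLike.congr_fun h w))
        rw [hcomm, hi.self_apply_inverse]
      rw [← this, hi.inverse_apply_self]
    simp only [ContinuousLinearMap.comp_apply, hc]
    have : posSqrt U (posSqrt U x) = U x := DFunLike.congr_fun h x
    rw [this, hi.inverse_apply_self]; rfl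
  · rw [ContinuousLinearMap.comp_assoc]
    change U.inverse ∘L (posSqrt U * posSqrt U) = _
    rw [h, hi.inverse_comp_self]

theorem inverse_apply_posSqrt [CompleteSpace E] {U : E →L[ℝ] E} (hsa : IsSelfAdjoint U)
    (hm : StronglyMonotone U) (x : E) : posSqrt U (U.inverse (posSqrt U x)) = x := by
  have hR := posSqrt_isInvertible hsa hm
  have hi := hm.isInvertible
  have h := (posSqrt_spec hsa hm).2
  have h1 : posSqrt U (posSqrt U (U.inverse (posSqrt U x))) = posSqrt U x := by
    change (posSqrt U * posSqrt U) _ = _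
    rw [h, hi.self_apply_inverse]
  rw [← hR.inverse_apply_self (posSqrt U (U.inverse (posSqrt U x))), h1, hR.inverse_apply_self]

theorem posSqrt_symm [CompleteSpace E] {U : E →L[ℝ] E} (hsa : IsSelfAdjoint U)
    (hm : StronglyMonotone U) (x y : E) :
    inner ℝ (posSqrt U x) y = inner ℝ x (posSqrt U y) :=
  (posSqrt_spec hsa hm).1.isSelfAdjoint.isSymmetric x y

theorem setResolvent_setComp_eq_singleton [CompleteSpace E] {U : E →L[ℝ] E}
    (hsa : IsSelfAdjoint U) (hm : StronglyMonotone U) {A : E → Set E} (hA : MaximallyMonotone A)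
    (x : E) : ∃ p, setResolvent (setComp U A) x = {p} := by
  have hi := hm.isInvertible
  have hR := posSqrt_isInvertible hsa hm
  have hRi := hR.self_apply_inverse
  have hsymm := posSqrt_symm hsa hm
  -- This is √U A √U, maximally monotone for the original inner product; Minty at `(√U)⁻¹ x` gives a
  -- point that √U maps into the resolvent.
  have hA' : MaximallyMonotone fun y => {u | (posSqrt U).inverse u ∈ A (posSqrt U y)} := by
    intro y u
    refine (hA _ _).trans ⟨fun h y' v hv => ?_, fun h y' v hv => ?_⟩
    · have := h _ _ hv
      rwa [← map_sub, ← map_sub, hsymm, hRi] at this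
    · have := h ((posSqrt U).inverse y') (posSqrt U v) (by
        simpa [hRi, hR.inverse_apply_self] using hv)
      rwa [← hRi y', ← map_sub, hsymm, map_sub (posSqrt U), hRi]
  obtain ⟨p, hp⟩ := hA'.exists_sub_mem ((posSqrt U).inverse x)
  have hmem : posSqrt U p ∈ setResolvent (setComp U A) x := by
    rw [mem_setResolvent_setComp_iff hi]
    have : U.inverse (x - posSqrt U p) = (posSqrt U).inverse ((posSqrt U).inverse x - p) := by
      rw [← hR.inverse_apply_self (U.inverse (x - posSqrt U p))]
      congr 1
      have : x - posSqrt U p = posSqrt U ((posSqrt U).inverse x - p) := by rw [map_sub, hRi]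
      rw [this, inverse_apply_posSqrt hsa hm]
    rw [this]
    exact hp
  refine ⟨_, Set.eq_singleton_iff_unique_mem.2 ⟨hmem, fun q hq => ?_⟩⟩
  rw [mem_setResolvent_setComp_iff hi] at hmem hq
  by_contra hne
  have h1 := hA.monotone hq hmem
  have h2 := hm.inverse_inner_self_pos (sub_ne_zero.2 hne)
  rw [← map_sub, sub_sub_sub_cancel_left, ← neg_sub q, map_neg, inner_neg_right] at h1
  linarith

end Minty

end PrimalDual

namespace PrimalDual

/-! ### The semi-inner product induced by V and its range -/

section SemiInner

variable {E : Type*} [NormedAddCommGroup E] [InnerProductSpace ℝ E]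

/-- The form `(z, w) ↦ ⟪z, V w⟫` is symmetric and positive semidefinite. -/
structure IsSemiInner (V : E →L[ℝ] E) : Prop where
  symm : ∀ z w, inner ℝ z (V w) = inner ℝ w (V z)
  nonneg : ∀ z, 0 ≤ inner ℝ z (V z)

namespace IsSemiInner

variable {V : E →L[ℝ] E} (h : IsSemiInner V)
include h

theorem expand_add_smul (z w : E) (t : ℝ) : inner ℝ (z + t • w) (V (z + t • w)) =
    inner ℝ z (V z) + 2 * t * inner ℝ z (V w) + t ^ 2 * inner ℝ w (V w) := by
  have := h.symm w z
  simp only [map_add, map_smul, inner_add_left, inner_add_right, inner_smul_right,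
    real_inner_smul_left]
  rw [this]; ring

theorem expand_sub (z w : E) : inner ℝ (z - w) (V (z - w)) =
    inner ℝ z (V z) - 2 * inner ℝ z (V w) + inner ℝ w (V w) := by
  have := h.expand_add_smul z w (-1)
  rw [neg_one_smul, ← sub_eq_add_neg] at this
  rw [this]; ring

theorem cauchy_schwarz (z w : E) :
    inner ℝ z (V w) ^ 2 ≤ inner ℝ z (V z) * inner ℝ w (V w) := by
  have := discrim_le_zero (a := inner ℝ w (V w)) (b := 2 * inner ℝ z (V w))
    (c := inner ℝ z (V z)) fun t => by
      have := h.nonneg (z + t • w)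
      rw [h.expand_add_smul] at this
      linarith
  rw [discrim] at this
  linarith

/-- Cauchy–Schwarz for the form at the pair `(V z, z)`, divided by `‖V z‖ ^ 2`. -/
theorem norm_sq_le (z : E) : ‖V z‖ ^ 2 ≤ ‖V‖ * inner ℝ z (V z) := by
  have h1 := h.cauchy_schwarz (V z) z
  rw [real_inner_self_eq_norm_sq] at h1
  have h2 : inner ℝ (V z) (V (V z)) ≤ ‖V‖ * ‖V z‖ ^ 2 := by
    refine (real_inner_le_norm _ _).trans ?_
    have := mul_le_mul_of_nonneg_left (V.le_opNorm (V z)) (norm_nonneg (V z))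
    linarith
  by_cases h0 : V z = 0
  · simp [h0]
  · have h3 : 0 < ‖V z‖ ^ 2 := pow_pos (norm_pos_iff.2 h0) 2
    have h4 := mul_le_mul_of_nonneg_right h2 (h.nonneg z)
    refine le_of_mul_le_mul_right ?_ h3
    linarith

theorem apply_eq_zero {z : E} (hz : inner ℝ z (V z) ≤ 0) : V z = 0 := by
  have := h.norm_sq_le z
  rw [le_antisymm hz (h.nonneg z), mul_zero] at this
  exact norm_eq_zero.1 (pow_eq_zero_iff two_ne_zero |>.1 (le_antisymm this (sq_nonneg _)))

theorem isSymmetric : (V : E →ₗ[ℝ] E).IsSymmetric := fun z w => by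
  rw [real_inner_comm]; exact h.symm w z

variable [CompleteSpace E] (hV : IsClosed (ran V : Set E))

omit h in
theorem projRan_mem (z : E) : projRan V hV z ∈ ran V := by
  have : CompleteSpace (ran V) := hV.completeSpace_coe
  exact (ran V).starProjection_apply_mem z

theorem map_projRan (z : E) : V (projRan V hV z) = V z := by
  have : CompleteSpace (ran V) := hV.completeSpace_coe
  have h1 : z - projRan V hV z ∈ (ran V)ᗮ := (ran V).sub_starProjection_mem_orthogonal z
  have h2 : (ran V)ᗮ = (V : E →ₗ[ℝ] E).ker := h.isSymmetric.orthogonal_range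
  rw [h2, LinearMap.mem_ker, ContinuousLinearMap.coe_coe, map_sub, sub_eq_zero] at h1
  exact h1.symm

theorem inner_projRan (z w : E) : inner ℝ (projRan V hV z) (V w) = inner ℝ z (V w) := by
  rw [h.symm, h.map_projRan, h.symm]

omit [CompleteSpace E] in
theorem eq_zero_of_mem_ran {z : E} (hz : z ∈ ran V) (h0 : V z = 0) : z = 0 := by
  have h1 : z ∈ (ran V)ᗮ := by
    rw [show (ran V)ᗮ = (V : E →ₗ[ℝ] E).ker from h.isSymmetric.orthogonal_range]
    exact h0
  exact inner_self_eq_zero.1 (h1 z hz)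

include hV in
/-- The form induced by `V` is coercive on the range of `V`, if the latter is closed. -/
theorem exists_coercive : ∃ c : ℝ, 0 < c ∧ ∀ z ∈ ran V, c * ‖z‖ ^ 2 ≤ inner ℝ z (V z) := by
  have : CompleteSpace (ran V) := hV.completeSpace_coe
  have hinj : Function.Injective (V ∘L (ran V).subtypeL) := by
    rw [injective_iff_map_eq_zero]
    intro z hz
    exact Subtype.ext (h.eq_zero_of_mem_ran z.2 hz)
  have hrange : Set.range (V ∘L (ran V).subtypeL) = (ran V : Set E) := by
    ext w
    constructor
    · rintro ⟨z, rfl⟩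
      exact ⟨z, rfl⟩
    · rintro ⟨z, rfl⟩
      exact ⟨⟨_, projRan_mem hV z⟩, h.map_projRan hV z⟩
  obtain ⟨k, hk⟩ := ContinuousLinearMap.antilipschitz_of_injective_of_isClosed_range _ hinj
    (by rw [hrange]; exact hV)
  have hbound : ∀ z ∈ ran V, ‖z‖ ≤ k * ‖V z‖ := fun z hz => by
    have := hk.le_mul_dist ⟨z, hz⟩ 0
    rw [map_zero, dist_zero_right, dist_zero_right] at this
    exact this
  -- The `+ 1` keeps the constant positive even when `k` or `V` is zero.
  refine ⟨(k ^ 2 * ‖V‖ + 1)⁻¹, by positivity, fun z hz => ?_⟩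
  rw [inv_mul_le_iff₀ (by positivity)]
  calc ‖z‖ ^ 2 ≤ (k * ‖V z‖) ^ 2 := pow_le_pow_left₀ (norm_nonneg _) (hbound z hz) 2
    _ = k ^ 2 * ‖V z‖ ^ 2 := mul_pow _ _ _
    _ ≤ k ^ 2 * (‖V‖ * inner ℝ z (V z)) :=
        mul_le_mul_of_nonneg_left (h.norm_sq_le z) (by positivity)
    _ ≤ (k ^ 2 * ‖V‖ + 1) * inner ℝ z (V z) := by linarith [h.nonneg z]

include hV in
theorem isHilbertSpaceFor : IsHilbertSpaceFor V (ran V) := by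
  obtain ⟨c, hc, hco⟩ := h.exists_coercive hV
  refine ⟨fun z _ w _ => h.symm z w, fun z hz hne => ?_, fun f hf hcau => ?_⟩
  · have := norm_pos_iff.2 hne
    exact lt_of_lt_of_le (by positivity) (hco z hz)
  · have hcf : CauchySeq f := by
      rw [Metric.cauchySeq_iff]
      intro ε hε
      obtain ⟨N, hN⟩ := hcau (c * ε ^ 2) (by positivity)
      refine ⟨N, fun m hm n hn => ?_⟩
      rw [dist_eq_norm]
      have := (hco _ ((ran V).sub_mem (hf m) (hf n))).trans_lt (hN m hm n hn)
      exact lt_of_pow_lt_pow_left₀ 2 hε.le (lt_of_mul_lt_mul_left this hc.le)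
    obtain ⟨z, hz⟩ := cauchySeq_tendsto_of_complete hcf
    refine ⟨z, hV.mem_of_tendsto hz (Eventually.of_forall hf), ?_⟩
    have hcont : Continuous fun w => inner ℝ (w - z) (V (w - z)) := by fun_prop
    have hlim := (hcont.tendsto z).comp hz
    rwa [sub_self, inner_zero_left] at hlim

end IsSemiInner

end SemiInner

/-! ### Krasnosel'skiĭ–Mann iteration in a seminorm -/

section Krasnoselskii

variable {E : Type*} [NormedAddCommGroup E] [InnerProductSpace ℝ E]

/-- Along an ultrafilter, every bounded sequence converges weakly. -/
theorem exists_weak_limit_ultrafilter [CompleteSpace E] (F : Ultrafilter ℕ) {y : ℕ → E} {C : ℝ}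
    (hy : ∀ n, ‖y n‖ ≤ C) :
    ∃ z, ∀ w, Tendsto (fun n => inner ℝ (y n) w) F (𝓝 (inner ℝ z w)) := by
  have hb : ∀ w n, |inner ℝ (y n) w| ≤ C * ‖w‖ := fun w n =>
    (abs_real_inner_le_norm _ _).trans (mul_le_mul_of_nonneg_right (hy n) (norm_nonneg w))
  -- Compactness of an interval gives each limit; the limits form a bounded linear functional,
  -- represented by Riesz.
  have hex : ∀ w, ∃ l, Tendsto (fun n => inner ℝ (y n) w) F (𝓝 l) := by
    intro w
    obtain ⟨l, -, hl⟩ := (isCompact_Icc (a := -(C * ‖w‖)) (b := C * ‖w‖)).ultrafilter_le_nhds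
      (F.map fun n => inner ℝ (y n) w)
      (by
        rw [le_principal_iff]
        exact Filter.mem_map.2 (Filter.univ_mem' fun n => abs_le.1 (hb w n)))
    exact ⟨l, hl⟩
  choose l hl using hex
  let φ : E →ₗ[ℝ] ℝ :=
    { toFun := l
      map_add' := fun a b => tendsto_nhds_unique (hl (a + b))
        (((hl a).add (hl b)).congr fun n => (inner_add_right _ _ _).symm)
      map_smul' := fun t a => tendsto_nhds_unique (hl (t • a))
        (((hl a).const_mul t).congr fun n => (inner_smul_right _ _ _).symm) }
  let Φ : StrongDual ℝ E := φ.mkContinuous C fun w => by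
    have hnorm : Tendsto (fun n => |inner ℝ (y n) w|) F (𝓝 |l w|) := (hl w).abs
    exact le_of_tendsto hnorm (Eventually.of_forall (hb w))
  refine ⟨(InnerProductSpace.toDual ℝ E).symm Φ, fun w => ?_⟩
  rw [InnerProductSpace.toDual_symm_apply]
  exact hl w

/-- A positive limit ℓ would give ℓ ∑ a ≤ C, against divergence. -/
theorem tendsto_zero_of_weighted_sum_le {r a : ℕ → ℝ} (hr : Antitone r) (h0 : ∀ n, 0 ≤ r n)
    (ha : ∀ n, 0 ≤ a n) {C : ℝ} (hC : ∀ N, ∑ n ∈ Finset.range N, a n * r n ≤ C)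
    (hdiv : Tendsto (fun N => ∑ n ∈ Finset.range N, a n) atTop atTop) :
    Tendsto r atTop (𝓝 0) := by
  have hbd : BddBelow (Set.range r) := ⟨0, by rintro _ ⟨n, rfl⟩; exact h0 n⟩
  have hlim := tendsto_atTop_ciInf hr hbd
  have hl0 : 0 ≤ ⨅ n, r n := le_ciInf h0
  rcases hl0.eq_or_lt with he | hlt
  · rwa [← he] at hlim
  · obtain ⟨N, hN⟩ := (hdiv.eventually_gt_atTop (C / ⨅ n, r n)).exists
    rw [div_lt_iff₀ hlt, Finset.sum_mul] at hN
    exact absurd ((Finset.sum_le_sum fun n _ =>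
      mul_le_mul_of_nonneg_left (ciInf_le hbd n) (ha n)).trans (hC N)) (not_le.2 hN)

/-- `J` is firmly nonexpansive for the form induced by `V`. -/
def FirmlyNonexpansiveFor (V : E →L[ℝ] E) (J : E → E) : Prop :=
  ∀ z w, inner ℝ (J z - J w) (V (J z - J w)) ≤ inner ℝ (J z - J w) (V (z - w))

variable {V : E →L[ℝ] E} {J : E → E}

theorem FirmlyNonexpansiveFor.nonexpansive (hJ : FirmlyNonexpansiveFor V J) (h : IsSemiInner V)
    (z w : E) : inner ℝ (J z - J w) (V (J z - J w)) ≤ inner ℝ (z - w) (V (z - w)) := by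
  have h1 := hJ z w
  have h2 := h.nonneg ((J z - J w) - (z - w))
  rw [h.expand_sub] at h2
  linarith

theorem FirmlyNonexpansiveFor.fejer (hJ : FirmlyNonexpansiveFor V J) (h : IsSemiInner V)
    {f : E} (hf : V (J f) = V f) (z : E) {t : ℝ} (ht : 0 ≤ t) :
    inner ℝ ((1 - t) • z + t • J z - f) (V ((1 - t) • z + t • J z - f)) +
      t * (2 - t) * inner ℝ (J z - z) (V (J z - z)) ≤ inner ℝ (z - f) (V (z - f)) := by
  have h0 : V (J z - J f) = V ((z - f) + (1 : ℝ) • (J z - z)) := by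
    rw [map_sub, hf, ← map_sub]; congr 1; module
  have h1 := hJ z f
  rw [h0, h.symm _ (z - f), h0, h.symm, h0, h.expand_add_smul, map_add, map_smul,
    inner_add_right, inner_smul_right] at h1
  have h2 : (1 - t) • z + t • J z - f = (z - f) + t • (J z - z) := by module
  rw [h2, h.expand_add_smul]
  have h3 : inner ℝ (J z - z) (V (J z - z)) + inner ℝ (z - f) (V (J z - z)) ≤ 0 := by linarith
  have h4 := mul_le_mul_of_nonneg_left h3 ht
  linarith

theorem FirmlyNonexpansiveFor.residual_le (hJ : FirmlyNonexpansiveFor V J) (h : IsSemiInner V)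
    (z : E) {t : ℝ} (ht : 0 ≤ t) (ht2 : t ≤ 2) :
    inner ℝ (J ((1 - t) • z + t • J z) - ((1 - t) • z + t • J z))
      (V (J ((1 - t) • z + t • J z) - ((1 - t) • z + t • J z))) ≤
      inner ℝ (J z - z) (V (J z - z)) := by
  rcases ht.eq_or_lt with rfl | hpos
  · simp
  set z' := (1 - t) • z + t • J z with hz'
  set δ := J z' - J z with hδ
  have h1 := hJ z' z
  rw [show z' - z = t • (J z - z) by rw [hz']; module, map_smul, inner_smul_right, ← hδ] at h1
  have h2 : J z' - z' = δ + (1 - t) • (J z - z) := by rw [hδ, hz']; module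
  rw [h2, h.expand_add_smul]
  -- This vector is `(J z' - J z) - (z' - z)`. Its form weighted by `2 - t`, with twice the firm
  -- inequality `h1`, yields `t` times the claim.
  have h3 := h.nonneg (δ + (-t) • (J z - z))
  rw [h.expand_add_smul] at h3
  have h4 := mul_nonneg (sub_nonneg.2 ht2) h3
  refine le_of_mul_le_mul_left ?_ hpos
  nlinarith

theorem tendsto_inner_zero_of_residual {α : Type*} {l : Filter α} (h : IsSemiInner V)
    {a d : α → E} {C : ℝ} (ha : ∀ n, inner ℝ (a n) (V (a n)) ≤ C)
    (hd : Tendsto (fun n => inner ℝ (d n) (V (d n))) l (𝓝 0)) :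
    Tendsto (fun n => inner ℝ (a n) (V (d n))) l (𝓝 0) := by
  have hsq : Tendsto (fun n => inner ℝ (a n) (V (d n)) ^ 2) l (𝓝 0) := by
    refine squeeze_zero (fun n => sq_nonneg _) (fun n => (h.cauchy_schwarz _ _).trans
      (mul_le_mul_of_nonneg_right (ha n) (h.nonneg _))) ?_
    simpa using hd.const_mul C
  have := hsq.sqrt
  simp only [Real.sqrt_sq_eq_abs, Real.sqrt_zero] at this
  exact (tendsto_zero_iff_abs_tendsto_zero _).2 this

/-- Demiclosedness: a weak limit of approximate fixed points is a fixed point. -/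
theorem FirmlyNonexpansiveFor.demiclosed {α : Type*} {l : Filter α} [l.NeBot]
    (hJ : FirmlyNonexpansiveFor V J) (h : IsSemiInner V) {z : α → E} {f y : E} {C : ℝ}
    (hb : ∀ n, inner ℝ (z n - f) (V (z n - f)) ≤ C)
    (hres : Tendsto (fun n => inner ℝ (J (z n) - z n) (V (J (z n) - z n))) l (𝓝 0))
    (hlim : ∀ w, Tendsto (fun n => inner ℝ (z n) (V w)) l (𝓝 (inner ℝ y (V w)))) :
    V (J y) = V y := by
  have hb' : ∀ n, inner ℝ (J (z n) - J y) (V (J (z n) - J y)) ≤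
      2 * C + 2 * inner ℝ (f - y) (V (f - y)) := by
    intro n
    have h1 := hJ.nonexpansive h (z n) y
    have h2 := h.nonneg ((z n - f) - (f - y))
    rw [h.expand_sub] at h2
    have h3 := h.expand_add_smul (z n - f) (f - y) 1
    rw [one_smul, sub_add_sub_cancel] at h3
    linarith [hb n]
  have l1 := tendsto_inner_zero_of_residual h hb' hres
  have l2 := tendsto_inner_zero_of_residual (l := l) (a := fun _ => y - J y) h
    (fun _ => le_rfl) hres
  have l3 := (hlim (y - J y)).sub_const (inner ℝ (J y) (V (y - J y)))
  have l4 := (l1.add l2).add l3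
  rw [zero_add, zero_add, ← inner_sub_left] at l4
  -- Firm nonexpansiveness at `z n` and `y`, expanded, says that every term of the sequence in `l4`
  -- is nonpositive.
  have hle : inner ℝ (y - J y) (V (y - J y)) ≤ 0 := by
    refine le_of_tendsto l4 (Eventually.of_forall fun n => ?_)
    have h1 := hJ (z n) y
    rw [show z n - y = (J (z n) - J y) - (J (z n) - z n) - (y - J y) by abel,
      map_sub V (_ - _) (y - J y), map_sub V (_ - J y), inner_sub_right, inner_sub_right] at h1
    have h2 := h.symm (J (z n) - J y) (y - J y)
    have h3 := h.symm (y - J y) (J (z n) - z n)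
    have h4 : inner ℝ (J (z n) - J y) (V (y - J y)) = inner ℝ (J (z n) - z n) (V (y - J y)) +
        (inner ℝ (z n) (V (y - J y)) - inner ℝ (J y) (V (y - J y))) := by
      rw [← inner_sub_left, ← inner_add_left]; congr 1; abel
    linarith
  have := h.apply_eq_zero hle
  rw [map_sub, sub_eq_zero] at this
  exact this.symm

/-- Weak convergence of the Krasnosel'skiĭ–Mann iteration, for a firmly nonexpansive operator with
respect to a positive semidefinite form with closed range. -/
theorem FirmlyNonexpansiveFor.exists_weak_limit [CompleteSpace E]
    (hJ : FirmlyNonexpansiveFor V J) (h : IsSemiInner V) (hV : IsClosed (ran V : Set E))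
    {f : E} (hf : V (J f) = V f) {lam : ℕ → ℝ} (hlam : ∀ n, lam n ∈ Set.Icc (0 : ℝ) 2)
    (hdiv : Tendsto (fun N => ∑ n ∈ Finset.range N, lam n * (2 - lam n)) atTop atTop)
    {z : ℕ → E} (hz : ∀ n, z (n + 1) = (1 - lam n) • z n + lam n • J (z n)) :
    ∃ y ∈ ran V, V (J y) = V y ∧
      ∀ w, Tendsto (fun n => inner ℝ (z n) (V w)) atTop (𝓝 (inner ℝ y (V w))) := by
  set r : ℕ → ℝ := fun n => inner ℝ (J (z n) - z n) (V (J (z n) - z n)) with hr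
  have hwt : ∀ n, 0 ≤ lam n * (2 - lam n) := fun n =>
    mul_nonneg (hlam n).1 (sub_nonneg.2 (hlam n).2)
  have hstep : ∀ a, V (J a) = V a → ∀ n, inner ℝ (z (n + 1) - a) (V (z (n + 1) - a)) +
      lam n * (2 - lam n) * r n ≤ inner ℝ (z n - a) (V (z n - a)) := fun a ha n => by
    rw [hz]; exact hJ.fejer h ha (z n) (hlam n).1
  have hanti : ∀ a, V (J a) = V a → Antitone fun n => inner ℝ (z n - a) (V (z n - a)) :=
    fun a ha => antitone_nat_of_succ_le fun n => by
      linarith [hstep a ha n, mul_nonneg (hwt n) (h.nonneg (J (z n) - z n))]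
  have hranti : Antitone r := antitone_nat_of_succ_le fun n => by
    simp only [hr]; rw [hz]; exact hJ.residual_le h (z n) (hlam n).1 (hlam n).2
  have hsum : ∀ N, ∑ n ∈ Finset.range N, lam n * (2 - lam n) * r n ≤
      inner ℝ (z 0 - f) (V (z 0 - f)) - inner ℝ (z N - f) (V (z N - f)) := by
    intro N
    induction N with
    | zero => simp
    | succ N ih => rw [Finset.sum_range_succ]; linarith [hstep f hf N]
  have hres : Tendsto r atTop (𝓝 0) :=
    tendsto_zero_of_weighted_sum_le hranti (fun n => h.nonneg _) hwt
      (fun N => (hsum N).trans (sub_le_self _ (h.nonneg _))) hdiv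
  obtain ⟨c, hc, hco⟩ := h.exists_coercive hV
  set P := projRan V hV
  have hbd : ∀ n, inner ℝ (z n - f) (V (z n - f)) ≤ inner ℝ (z 0 - f) (V (z 0 - f)) :=
    fun n => hanti f hf (Nat.zero_le n)
  -- Only the projections are bounded: the form does not control the component of `z n` in the
  -- kernel of `V`.
  have hnorm : ∀ n, ‖P (z n)‖ ≤ √(inner ℝ (z 0 - f) (V (z 0 - f)) / c) + ‖P f‖ := by
    intro n
    have h1 := hco _ (IsSemiInner.projRan_mem hV (z n - f))
    rw [h.map_projRan, h.inner_projRan] at h1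
    have h2 : ‖P (z n - f)‖ ≤ √(inner ℝ (z 0 - f) (V (z 0 - f)) / c) := by
      refine Real.le_sqrt_of_sq_le ?_
      rw [le_div_iff₀' hc]
      exact h1.trans (hbd n)
    calc ‖P (z n)‖ = ‖P (z n - f) + P f‖ := by rw [← map_add, sub_add_cancel]
      _ ≤ _ := (norm_add_le _ _).trans (by linarith)
  have hex : ∀ F : Ultrafilter ℕ, (F : Filter ℕ) ≤ atTop → ∃ y ∈ ran V, V (J y) = V y ∧
      ∀ w, Tendsto (fun n => inner ℝ (z n) (V w)) F (𝓝 (inner ℝ y (V w))) := by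
    intro F hF
    obtain ⟨y, hy⟩ := exists_weak_limit_ultrafilter F hnorm
    have hlim : ∀ w, Tendsto (fun n => inner ℝ (z n) (V w)) F
        (𝓝 (inner ℝ (P y) (V w))) := fun w => by
      rw [h.inner_projRan]
      exact (hy (V w)).congr fun n => h.inner_projRan hV _ _
    exact ⟨P y, IsSemiInner.projRan_mem hV y,
      hJ.demiclosed h hbd (hres.mono_left hF) hlim, hlim⟩
  obtain ⟨y, hyr, hyf, hy⟩ := hex (Ultrafilter.of atTop) (Ultrafilter.of_le atTop)
  refine ⟨y, hyr, hyf, fun w => (tendsto_iff_ultrafilter _ _ _).2 fun F hF => ?_⟩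
  obtain ⟨y', hyr', hyf', hy'⟩ := hex F hF
  have hconv : ∀ a, V (J a) = V a →
      ∃ l, Tendsto (fun n => inner ℝ (z n - a) (V (z n - a))) atTop (𝓝 l) := fun a ha =>
    ⟨_, tendsto_atTop_ciInf (hanti a ha) ⟨0, by rintro _ ⟨n, rfl⟩; exact h.nonneg _⟩⟩
  obtain ⟨l, hl⟩ := hconv y hyf
  obtain ⟨l', hl'⟩ := hconv y' hyf'
  -- Opial's argument: the difference of the two convergent squared distances is affine in `z n`, so
  -- pairing with `V (y' - y)` has one limit along both ultrafilters.
  have hdiff : Tendsto (fun n => inner ℝ (z n) (V (y' - y))) atTop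
      (𝓝 ((l - l' - (inner ℝ y (V y) - inner ℝ y' (V y'))) / 2)) := by
    refine (((hl.sub hl').sub_const _).div_const 2).congr fun n => ?_
    rw [h.expand_sub, h.expand_sub, map_sub, inner_sub_right]
    ring
  have he := tendsto_nhds_unique (hy (y' - y)) (hdiff.mono_left (Ultrafilter.of_le atTop))
  have he' := tendsto_nhds_unique (hy' (y' - y)) (hdiff.mono_left hF)
  have hzero : V (y' - y) = 0 := h.apply_eq_zero (by rw [inner_sub_left, he, he', sub_self])
  have hyy : y' = y :=
    sub_eq_zero.1 (h.eq_zero_of_mem_ran ((ran V).sub_mem hyr' hyr) hzero)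
  rw [← hyy]
  exact hy' w

end Krasnoselskii

end PrimalDual

namespace PrimalDual

/-! ### The operators V, M and W of the primal-dual problem -/

section PrimalDualOperators

section Inverse

variable {E : Type*} [NormedAddCommGroup E] [InnerProductSpace ℝ E] [CompleteSpace E]
  {U : E →L[ℝ] E}

theorem inner_inverse_symm (hsa : IsSelfAdjoint U) (hm : StronglyMonotone U) (x y : E) :
    inner ℝ x (U.inverse y) = inner ℝ y (U.inverse x) := by
  have hi := hm.isInvertible
  have hs : inner ℝ (U (U.inverse x)) (U.inverse y) = inner ℝ (U.inverse x) (U (U.inverse y)) :=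
    hsa.isSymmetric _ _
  rw [hi.self_apply_inverse, hi.self_apply_inverse] at hs
  rw [hs, real_inner_comm]

theorem inner_posSqrt_inverse_posSqrt (hsa : IsSelfAdjoint U) (hm : StronglyMonotone U) (a : E) :
    inner ℝ (posSqrt U a) (U.inverse (posSqrt U a)) = ‖a‖ ^ 2 := by
  rw [posSqrt_symm hsa hm, inverse_apply_posSqrt hsa hm, real_inner_self_eq_norm_sq]

end Inverse

variable {H G : Type*} [NormedAddCommGroup H] [InnerProductSpace ℝ H] [CompleteSpace H]
  [NormedAddCommGroup G] [InnerProductSpace ℝ G] [CompleteSpace G]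
  {A : H → Set H} {B : G → Set G} {L : H →L[ℝ] G} {U : H →L[ℝ] H} {S : G →L[ℝ] G}

theorem inner_opV (z w : WithLp 2 (H × G)) : inner ℝ z (opV U S L w) =
    inner ℝ z.fst (U.inverse w.fst) + inner ℝ z.snd (S.inverse w.snd) -
      inner ℝ (L z.fst) w.snd - inner ℝ (L w.fst) z.snd := by
  have : inner ℝ z (opV U S L w) = inner ℝ z.fst (U.inverse w.fst - L.adjoint w.snd) +
      inner ℝ z.snd (S.inverse w.snd - L w.fst) := rfl
  rw [this, inner_sub_right, inner_sub_right, ContinuousLinearMap.adjoint_inner_right,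
    real_inner_comm (L w.fst) z.snd]
  ring

/-- With x = √Υ a and u = √Σ b the form becomes ‖a‖² + ‖b‖² - 2⟪√Σ L √Υ a, b⟫ ≥ (‖a‖ - ‖b‖)². -/
theorem isSemiInner_opV (hUsa : IsSelfAdjoint U) (hUsm : StronglyMonotone U)
    (hSsa : IsSelfAdjoint S) (hSsm : StronglyMonotone S)
    (hnorm : ‖posSqrt S ∘L L ∘L posSqrt U‖ ≤ 1) : IsSemiInner (opV U S L) where
  symm z w := by
    rw [inner_opV, inner_opV, inner_inverse_symm hUsa hUsm, inner_inverse_symm hSsa hSsm]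
    ring
  nonneg z := by
    obtain ⟨a, ha⟩ : ∃ a, posSqrt U a = z.fst :=
      ⟨_, (posSqrt_isInvertible hUsa hUsm).self_apply_inverse _⟩
    obtain ⟨b, hb⟩ : ∃ b, posSqrt S b = z.snd :=
      ⟨_, (posSqrt_isInvertible hSsa hSsm).self_apply_inverse _⟩
    rw [inner_opV, ← ha, ← hb, inner_posSqrt_inverse_posSqrt hUsa hUsm,
      inner_posSqrt_inverse_posSqrt hSsa hSsm, ← posSqrt_symm hSsa hSsm]
    have h1 : ‖posSqrt S (L (posSqrt U a))‖ ≤ ‖a‖ := by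
      simpa using (posSqrt S ∘L L ∘L posSqrt U).le_of_opNorm_le hnorm a
    have h2 := (real_inner_le_norm (posSqrt S (L (posSqrt U a))) b).trans
      (mul_le_mul_of_nonneg_right h1 (norm_nonneg b))
    nlinarith [sq_nonneg (‖a‖ - ‖b‖)]

theorem mem_setResolvent_opW_iff {z w : WithLp 2 (H × G)} :
    w ∈ setResolvent (opW A B U S L) z ↔ opV U S L (z - w) ∈ opM A B L w := by
  constructor
  · rintro ⟨a, ha, rfl⟩
    rw [add_sub_cancel_left]
    exact ha
  · intro h
    exact ⟨z - w, h, by abel⟩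

/-- The term L* `w.snd` occurs in both V and M and cancels from the first inclusion, while L `w.fst`
doubles in the second: hence the extrapolation 2p - x. -/
theorem mem_setResolvent_opW_iff_fst_snd (hU : U.IsInvertible) (hS : S.IsInvertible)
    {z w : WithLp 2 (H × G)} : w ∈ setResolvent (opW A B U S L) z ↔
      w.fst ∈ setResolvent (setComp U A) (z.fst - U (L.adjoint z.snd)) ∧
      w.snd ∈ setResolvent (setComp S (setInv B))
        (z.snd + S (L ((2 : ℝ) • w.fst - z.fst))) := by
  rw [mem_setResolvent_opW_iff, mem_setResolvent_setComp_iff hU, mem_setResolvent_setComp_iff hS]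
  have h1 : U.inverse (z.fst - U (L.adjoint z.snd) - w.fst) + L.adjoint w.snd =
      (opV U S L (z - w)).fst := by
    change _ = U.inverse (z.fst - w.fst) - L.adjoint (z.snd - w.snd)
    rw [sub_right_comm, map_sub U.inverse, hU.inverse_apply_self, map_sub L.adjoint]
    abel
  have h2 : S.inverse (z.snd + S (L ((2 : ℝ) • w.fst - z.fst)) - w.snd) - L w.fst =
      (opV U S L (z - w)).snd := by
    change _ = S.inverse (z.snd - w.snd) - L (z.fst - w.fst)
    rw [add_sub_right_comm, map_add S.inverse, hS.inverse_apply_self, two_smul, map_sub L,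
      map_sub L, map_add L]
    abel
  refine and_congr ⟨?_, fun h => ⟨_, h, h1.symm⟩⟩ ⟨?_, fun h => ⟨_, h, h2.symm⟩⟩
  · rintro ⟨a, ha, he⟩
    rwa [add_right_cancel (h1.trans he)]
  · rintro ⟨b, hb, he⟩
    rwa [sub_left_inj.1 (h2.trans he)]

theorem zero_mem_opM_iff {z : WithLp 2 (H × G)} : 0 ∈ opM A B L z ↔ z ∈ solutions A B L := by
  simp only [opM, solutions, Set.mem_ofPred_eq, WithLp.zero_fst, WithLp.zero_snd, eq_comm]

/-- The coupling (x, u) ↦ (L*u, -Lx) is skew, so it contributes nothing to the pairing. -/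
theorem opM_monotone (hA : MaximallyMonotone A) (hB : MaximallyMonotone B)
    {z w s t : WithLp 2 (H × G)} (hs : s ∈ opM A B L z) (ht : t ∈ opM A B L w) :
    0 ≤ inner ℝ (z - w) (s - t) := by
  obtain ⟨⟨a, ha, hsa⟩, b, hb, hsb⟩ := hs
  obtain ⟨⟨a', ha', hta⟩, b', hb', htb⟩ := ht
  have h1 := hA.monotone ha ha'
  have h2 := hB.setInv.monotone hb hb'
  have h3 : inner ℝ (z - w) (s - t) =
      inner ℝ (z.fst - w.fst) (s.fst - t.fst) + inner ℝ (z.snd - w.snd) (s.snd - t.snd) := rfl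
  have h4 : s.fst - t.fst = (a - a') + L.adjoint (z.snd - w.snd) := by
    rw [hsa, hta, map_sub]; abel
  have h5 : s.snd - t.snd = (b - b') - L (z.fst - w.fst) := by
    rw [hsb, htb, map_sub]; abel
  rw [h3, h4, h5, inner_add_right, inner_sub_right (z.snd - w.snd), ContinuousLinearMap.adjoint_inner_right,
    real_inner_comm (L (z.fst - w.fst)) (z.snd - w.snd)]
  linarith

theorem setResolvent_opW_eq_singleton (hA : MaximallyMonotone A) (hB : MaximallyMonotone B)
    (hUsa : IsSelfAdjoint U) (hUsm : StronglyMonotone U)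
    (hSsa : IsSelfAdjoint S) (hSsm : StronglyMonotone S) (z : WithLp 2 (H × G)) :
    ∃ w, setResolvent (opW A B U S L) z = {w} := by
  obtain ⟨p, hp⟩ := setResolvent_setComp_eq_singleton hUsa hUsm hA
    (z.fst - U (L.adjoint z.snd))
  obtain ⟨q, hq⟩ := setResolvent_setComp_eq_singleton hSsa hSsm hB.setInv
    (z.snd + S (L ((2 : ℝ) • p - z.fst)))
  have hiff := fun w => mem_setResolvent_opW_iff_fst_snd (A := A) (B := B) (L := L)
    hUsm.isInvertible hSsm.isInvertible (z := z) (w := w)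
  refine ⟨WithLp.toLp 2 (p, q), Set.eq_singleton_iff_unique_mem.2 ⟨?_, fun w hw => ?_⟩⟩
  · refine (hiff _).2 ⟨?_, ?_⟩
    · change p ∈ setResolvent (setComp U A) (z.fst - U (L.adjoint z.snd))
      rw [hp]; rfl
    · change q ∈ setResolvent (setComp S (setInv B)) (z.snd + S (L ((2 : ℝ) • p - z.fst)))
      rw [hq]; rfl
  · obtain ⟨h1, h2⟩ := (hiff w).1 hw
    rw [hp, Set.mem_singleton_iff] at h1
    rw [h1, hq, Set.mem_singleton_iff] at h2
    exact WithLp.ofLp_injective 2 (Prod.ext h1 h2)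

theorem firmlyNonexpansiveFor_opV (hA : MaximallyMonotone A) (hB : MaximallyMonotone B)
    {J : WithLp 2 (H × G) → WithLp 2 (H × G)}
    (hJ : ∀ z, J z ∈ setResolvent (opW A B U S L) z) :
    FirmlyNonexpansiveFor (opV U S L) J := by
  intro z w
  have h := opM_monotone hA hB (mem_setResolvent_opW_iff.1 (hJ z))
    (mem_setResolvent_opW_iff.1 (hJ w))
  rw [← map_sub, sub_sub_sub_comm, map_sub, inner_sub_right] at h
  linarith

end PrimalDualOperators

end PrimalDual

/-! ### The main theorem -/

theorem theorem3p3 {H G : Type*}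
    [NormedAddCommGroup H] [InnerProductSpace ℝ H] [CompleteSpace H]
    [NormedAddCommGroup G] [InnerProductSpace ℝ G] [CompleteSpace G]
    (A : H → Set H) (hA : PrimalDual.MaximallyMonotone A)
    (B : G → Set G) (hB : PrimalDual.MaximallyMonotone B)
    (L : H →L[ℝ] G)
    (hZ : (PrimalDual.solutions A B L).Nonempty)
    (U : H →L[ℝ] H) (hUsa : IsSelfAdjoint U) (hUsm : PrimalDual.StronglyMonotone U)
    (S : G →L[ℝ] G) (hSsa : IsSelfAdjoint S) (hSsm : PrimalDual.StronglyMonotone S)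
    (hnorm : ‖PrimalDual.posSqrt S ∘L L ∘L PrimalDual.posSqrt U‖ ≤ 1)
    (hV : IsClosed (PrimalDual.ran (PrimalDual.opV U S L) : Set (WithLp 2 (H × G)))) :
    -- the resolvents are defined everywhere and single-valued
    (∀ x, ∃ p, PrimalDual.setResolvent (PrimalDual.setComp U A) x = {p}) ∧
    (∀ u, ∃ q, PrimalDual.setResolvent (PrimalDual.setComp S (PrimalDual.setInv B)) u = {q}) ∧
    (∀ z, ∃ w, PrimalDual.setResolvent (PrimalDual.opW A B U S L) z = {w}) ∧
    -- the range of `V` with the form induced by `V` is a Hilbert space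
    PrimalDual.IsHilbertSpaceFor (PrimalDual.opV U S L)
      (PrimalDual.ran (PrimalDual.opV U S L)) ∧
    -- convergence of the algorithm
    ∀ (lam : ℕ → ℝ), (∀ n, lam n ∈ Set.Icc (0 : ℝ) 2) →
      Filter.Tendsto (fun N => ∑ n ∈ Finset.range N, lam n * (2 - lam n))
        Filter.atTop Filter.atTop →
      ∀ (x p : ℕ → H) (u q : ℕ → G),
        (∀ n, p (n + 1) ∈ PrimalDual.setResolvent (PrimalDual.setComp U A)
          (x n - U (L.adjoint (u n)))) →
        (∀ n, q (n + 1) ∈ PrimalDual.setResolvent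
          (PrimalDual.setComp S (PrimalDual.setInv B))
          (u n + S (L ((2 : ℝ) • p (n + 1) - x n)))) →
        (∀ n, x (n + 1) = (1 - lam n) • x n + lam n • p (n + 1)) →
        (∀ n, u (n + 1) = (1 - lam n) • u n + lam n • q (n + 1)) →
        ∃ (yh : H) (vh : G),
          WithLp.toLp 2 (yh, vh) ∈ PrimalDual.setFix (fun z =>
            PrimalDual.projRan (PrimalDual.opV U S L) hV ''
              PrimalDual.setResolvent (PrimalDual.opW A B U S L) z) ∧
          PrimalDual.WeaklyConvergesIn (PrimalDual.opV U S L)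
            (PrimalDual.ran (PrimalDual.opV U S L))
            (fun n => PrimalDual.projRan (PrimalDual.opV U S L) hV (WithLp.toLp 2 (x n, u n)))
            (WithLp.toLp 2 (yh, vh)) ∧
          ∃ (xh : H) (uh : G),
            PrimalDual.setResolvent (PrimalDual.setComp U A) (yh - U (L.adjoint vh)) = {xh} ∧
            PrimalDual.setResolvent (PrimalDual.setComp S (PrimalDual.setInv B))
              (vh + S (L ((2 : ℝ) • xh - yh))) = {uh} ∧
            WithLp.toLp 2 (xh, uh) ∈ PrimalDual.solutions A B L := by
  have hres := PrimalDual.setResolvent_opW_eq_singleton (L := L) hA hB hUsa hUsm hSsa hSsm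
  have hVs := PrimalDual.isSemiInner_opV (L := L) hUsa hUsm hSsa hSsm hnorm
  have hresU := PrimalDual.setResolvent_setComp_eq_singleton hUsa hUsm hA
  have hresS := PrimalDual.setResolvent_setComp_eq_singleton hSsa hSsm hB.setInv
  refine ⟨hresU, hresS, hres, hVs.isHilbertSpaceFor hV, ?_⟩
  intro lam hlam hdiv x p u q hp hq hx hu
  choose J hJ using hres
  have hJmem : ∀ z, J z ∈ PrimalDual.setResolvent (PrimalDual.opW A B U S L) z := fun z => by
    rw [hJ z]; rfl
  have hiff : ∀ z w, w ∈ PrimalDual.setResolvent (PrimalDual.opW A B U S L) z ↔ _ := fun z w =>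
    PrimalDual.mem_setResolvent_opW_iff_fst_snd hUsm.isInvertible hSsm.isInvertible
  obtain ⟨f, hf⟩ := hZ
  have hfJ : J f = f := by
    have hmem : f ∈ PrimalDual.setResolvent (PrimalDual.opW A B U S L) f := by
      rw [PrimalDual.mem_setResolvent_opW_iff, sub_self, map_zero]
      exact PrimalDual.zero_mem_opM_iff.2 hf
    rw [hJ f] at hmem
    exact hmem.symm
  -- The algorithm is the relaxed iteration of `J`, by uniqueness of the resolvent value.
  have hz : ∀ n, WithLp.toLp 2 (x (n + 1), u (n + 1)) =
      (1 - lam n) • WithLp.toLp 2 (x n, u n) + lam n • J (WithLp.toLp 2 (x n, u n)) := by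
    intro n
    have hmem := (hiff (WithLp.toLp 2 (x n, u n)) (WithLp.toLp 2 (p (n + 1), q (n + 1)))).2
      ⟨hp n, hq n⟩
    rw [hJ, Set.mem_singleton_iff] at hmem
    rw [← hmem, hx, hu]
    rfl
  obtain ⟨y, hyr, hyJ, hy⟩ :=
    (PrimalDual.firmlyNonexpansiveFor_opV hA hB hJmem).exists_weak_limit hVs hV
      (congrArg _ hfJ) hlam hdiv (z := fun n => WithLp.toLp 2 (x n, u n)) hz
  have hsol : J y ∈ PrimalDual.solutions A B L := by
    have h := PrimalDual.mem_setResolvent_opW_iff.1 (hJmem y)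
    rw [map_sub, hyJ, sub_self] at h
    exact PrimalDual.zero_mem_opM_iff.1 h
  obtain ⟨hJ1, hJ2⟩ := (hiff y (J y)).1 (hJmem y)
  refine ⟨y.fst, y.snd, ⟨J y, hJmem y, ?_⟩, ⟨fun n => PrimalDual.IsSemiInner.projRan_mem hV _,
    hyr, fun w _ => ?_⟩, (J y).fst, (J y).snd, ?_, ?_, hsol⟩
  -- Both sides lie in ran V and have the same image under V, which is injective there.
  · change PrimalDual.projRan (PrimalDual.opV U S L) hV (J y) = y
    refine sub_eq_zero.1 (hVs.eq_zero_of_mem_ran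
      (Submodule.sub_mem _ (PrimalDual.IsSemiInner.projRan_mem hV _) hyr) ?_)
    rw [map_sub, hVs.map_projRan, hyJ, sub_self]
  · exact (hy w).congr fun n => (hVs.inner_projRan hV _ _).symm
  · obtain ⟨a, ha⟩ := hresU (y.fst - U (L.adjoint y.snd))
    rw [ha] at hJ1 ⊢
    rw [Set.mem_singleton_iff.1 hJ1]
  · obtain ⟨b, hb⟩ := hresS (y.snd + S (L ((2 : ℝ) • (J y).fst - y.fst)))
    rw [hb] at hJ2 ⊢
    rw [Set.mem_singleton_iff.1 hJ2]
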